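/- **Setting.** Let $D\ge 1$ and let $G_n=(V_n,E_n)$ be finite simple graphs all of whose degrees are at most $D$. A sequence of random elements $X_n$ of a metric space $S$ satisfies the Large Deviations Principle (LDP) with normalization $\theta_n>0$, $\theta_n\to\infty$, and rate function $I$ if $I:S\to[0,\infty]$ is lower semicontinuous and for every Borel set $A\subset S$ $$-\inf_{A^\circ} I\le\liminf_n\frac{\log\mathbb P(X_n\in A^\circ)}{\theta_n}\le\limsup_n\frac{\log\mathbb P(X_n\in\bar A)}{\theta_n}\le-\inf_{\bar A} I .$$ *LD-convergence.* Let $\mathcal M^d$ be the space of Borel measures on $[0,1]^d$ of total mass at most $D$, with the topology of weak convergence. For $\sigma:V_n\to[0,1]$ put $\rho(\sigma)=|V_n|^{-1}\sum_{u}\delta_{\sigma(u)}$ and $\mu(\sigma)=|V_n|^{-1}\sum_{(u,v):u\sim v}\delta_{(\sigma(u),\sigma(v))}$, the last sum being over ordered pairs. The sequence $(G_n)$ is *LD-convergent* if, for $\sigma_n:V_n\to[0,1]$ with i.i.d. uniform values, $(\rho(\sigma_n),\mu(\sigma_n))$ satisfies the LDP in $\mathcal M^1\times\mathcal M^2$ with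 normalization $|V_n|$ and some rate function. (In particular $|V_n|\to\infty$.) *Quotients.* For $k\ge1$ and $\sigma:V_n\to\{1,\dots,k\}$ put $x_i(\sigma)=|\sigma^{-1}(i)|/|V_n|$ and $X_{ij}(\sigma)=|V_n|^{-1}\,|\{(u,v): \sigma(u)=i,\ \sigma(v)=j,\ u\sim v\}|$. A function $I_k:[0,D]^{(k+1)\times k}\to[0,\infty]$ is the *$k$-quotient rate function* of $(G_n)$ if, for $\sigma_n$ uniformly distributed on the maps $V_n\to\{1,\dots,k\}$, $(x(\sigma_n),X(\sigma_n))$ satisfies the LDP in $[0,D]^{(k+1)\times k}$ with normalization $|V_n|$ and rate function $I_k$. *Target graphs.* A soft-core graph $H$ on $k$ nodes consists of node weights $\alpha_i>0$ and a symmetric matrix of edge weights $A_{ij}>0$ ($1\le i,j\le k$). Put $$\hom(G,H)=\sum_{\sigma:V(G)\to\{1,\dots,k\}}\ \prod_{u\in V(G)}\alpha_{\sigma(u)}\prod_{\{u,v\}\in E(G)}A_{\sigma(u)\sigma(v)},\qquad \mathcal E_H(x,X)=-\sum_i x_i\log\alpha_i-\tfrac12\sum_{i,j}X_{ij}\log A_{ij}.$$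 The sequence $(G_n)$ is *right-convergent* if $\lim_n |V_n|^{-1}\log\hom(G_n,H)$ exists in $\mathbb R$ for every soft-core graph $H$. **Theorem.** If $(G_n)$ is LD-convergent, then it is right-convergent. Moreover, for every $k\ge1$ the $k$-quotient rate function $I_k$ exists and is unique, and for every soft-core graph $H$ on $k$ nodes the following limit exists in $\mathbb R$ and $$-\lim_{n\to\infty}\frac1{|V_n|}\log\hom(G_n,H)=\inf_{(x,X)\in[0,D]^{(k+1)\times k}}\bigl(\mathcal E_H(x,X)-\log k+I_k(x,X)\bigr).$$ -/

import Mathlib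

open MeasureTheory Filter Topology
open scoped NNReal ENNReal

universe u v

noncomputable section

namespace SparseGraph

/-! ### Large deviations principle -/

/-- `SatisfiesLDP P X θ I`: the random elements `X n` of the (metrizable) topological space `S`,
defined on the probability spaces `(Ω n, P n)`, satisfy the Large Deviations Principle with
normalization `θ` and rate function `I : S → [0, ∞]`.

Logarithms, `liminf`, `limsup` and infima are taken in the extended reals, so that `log 0 = -∞` and
`inf ∅ = +∞`. Below, `X n` is always continuous or has a finite domain, hence `X n ⁻¹' A` is an
event for every open or closed set `A`. -/
structure SatisfiesLDP {S : Type v} [TopologicalSpace S] {Ω : ℕ → Type u}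
    [∀ n, MeasurableSpace (Ω n)] (P : ∀ n, Measure (Ω n)) (X : ∀ n, Ω n → S)
    (θ : ℕ → ℝ) (I : S → ℝ≥0∞) : Prop where
  isProb : ∀ n, IsProbabilityMeasure (P n)
  rate_pos : ∀ n, 0 < θ n
  rate_tendsto : Tendsto θ atTop atTop
  lowerSemicontinuous : LowerSemicontinuous I
  lower_bound : ∀ A : Set S,
    -(⨅ s ∈ interior A, (I s : EReal)) ≤
      liminf (fun n => ENNReal.log (P n (X n ⁻¹' interior A)) / (θ n : EReal)) atTop
  upper_bound : ∀ A : Set S,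
    limsup (fun n => ENNReal.log (P n (X n ⁻¹' closure A)) / (θ n : EReal)) atTop ≤
      -(⨅ s ∈ closure A, (I s : EReal))

/-! ### Sparse graph sequences -/

open Classical in
/-- A sparse graph sequence: finite simple graphs `G_n` on vertex sets `V n`, together with a
constant `D ≥ 1` that bounds all degrees of all the graphs. -/
structure SparseGraphSeq where
  V : ℕ → Type u
  instFintype : ∀ n, Fintype (V n)
  graph : ∀ n, SimpleGraph (V n)
  D : ℝ≥0
  one_le_D : 1 ≤ D
  degree_le : ∀ n (w : V n), ((graph n).degree w : ℝ≥0) ≤ D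

attribute [instance] SparseGraphSeq.instFintype

/-! ### The random measures and LD-convergence -/

/-- The space of Borel measures on `E` of total mass at most `D`, with the topology of weak
convergence (induced from `FiniteMeasure E`). -/
abbrev BoundedMeasure (E : Type v) [MeasurableSpace E] (D : ℝ≥0) : Type v :=
  {μ : FiniteMeasure E // μ.mass ≤ D}

/-- The unit point mass at `x`. -/
def pointMass {E : Type v} [MeasurableSpace E] (x : E) : FiniteMeasure E :=
  ⟨Measure.dirac x, inferInstance⟩

theorem mass_pointMass {E : Type v} [MeasurableSpace E] (x : E) : (pointMass x).mass = 1 := by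
  simp [pointMass, FiniteMeasure.mass]

theorem mass_smul_sum {E : Type v} [MeasurableSpace E] {ι : Type u} (s : Finset ι) (c : ℝ≥0)
    (f : ι → FiniteMeasure E) : (c • ∑ i ∈ s, f i).mass = c * ∑ i ∈ s, (f i).mass := by
  classical
  have h : (∑ i ∈ s, f i).mass = ∑ i ∈ s, (f i).mass := by
    induction s using Finset.induction_on with
    | empty => simp
    | insert a s ha ih =>
      rw [Finset.sum_insert ha, Finset.sum_insert ha, ← ih]
      simp [FiniteMeasure.mass]
  rw [← h]
  simp [FiniteMeasure.mass]

theorem card_inv_mul_le {V : Type u} [Fintype V] (f : V → ℝ≥0) (D : ℝ≥0) (h : ∀ w, f w ≤ D) :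
    (Fintype.card V : ℝ≥0)⁻¹ * ∑ w, f w ≤ D := by
  rcases Nat.eq_zero_or_pos (Fintype.card V) with h0 | h0
  · simp [h0]
  · have hc : (0 : ℝ≥0) < Fintype.card V := by exact_mod_cast h0
    rw [inv_mul_le_iff₀ hc]
    calc ∑ w, f w ≤ ∑ _w : V, D := Finset.sum_le_sum fun w _ => h w
      _ = Fintype.card V * D := by simp

/-- `ρ(σ) = ∑_u |V|⁻¹ δ_{σ(u)}`. -/
def rhoMeasure {V : Type u} [Fintype V] (σ : V → unitInterval) : FiniteMeasure unitInterval :=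
  (Fintype.card V : ℝ≥0)⁻¹ • ∑ w, pointMass (σ w)

open Classical in
/-- `μ(σ) = ∑_{(u,v)} |V|⁻¹ δ_{(σ(u), σ(v))}`, the sum being over oriented edges. -/
def muMeasure {V : Type u} [Fintype V] (G : SimpleGraph V) (σ : V → unitInterval) :
    FiniteMeasure (unitInterval × unitInterval) :=
  (Fintype.card V : ℝ≥0)⁻¹ • ∑ w, ∑ w' ∈ G.neighborFinset w, pointMass (σ w, σ w')

theorem mass_rhoMeasure_le {V : Type u} [Fintype V] (σ : V → unitInterval) {D : ℝ≥0} (hD : 1 ≤ D) :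
    (rhoMeasure σ).mass ≤ D := by
  rw [rhoMeasure, mass_smul_sum]
  exact card_inv_mul_le _ _ fun w => by simpa [mass_pointMass] using hD

open Classical in
theorem mass_muMeasure_le {V : Type u} [Fintype V] (G : SimpleGraph V) (σ : V → unitInterval) {D : ℝ≥0}
    (hD : ∀ w, (G.degree w : ℝ≥0) ≤ D) : (muMeasure G σ).mass ≤ D := by
  rw [muMeasure, mass_smul_sum]
  refine card_inv_mul_le _ _ fun w => ?_
  have := mass_smul_sum (G.neighborFinset w) 1 fun w' => pointMass (σ w, σ w')
  rw [one_smul, one_mul] at this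
  rw [this]
  simpa [mass_pointMass] using hD w

/-- The pair `(ρ(σ), μ(σ))` for the `n`-th graph of the sequence, as an element of the space of
pairs of measures on `[0,1]` and `[0,1]²` of total mass at most `D`. -/
def SparseGraphSeq.measurePair (G : SparseGraphSeq.{u}) (n : ℕ) (σ : G.V n → unitInterval) :
    BoundedMeasure unitInterval G.D × BoundedMeasure (unitInterval × unitInterval) G.D :=
  (⟨rhoMeasure σ, mass_rhoMeasure_le σ G.one_le_D⟩,
   ⟨muMeasure (G.graph n) σ, mass_muMeasure_le (G.graph n) σ (G.degree_le n)⟩)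

/-- LD-convergence: when the vertices of `G_n` receive independent uniform colors in `[0,1]`, the
random pairs `(ρ(σ_n), μ(σ_n))` satisfy the LDP with normalization `|V_n|`. -/
def SparseGraphSeq.LDConvergent (G : SparseGraphSeq.{u}) : Prop :=
  ∃ J : BoundedMeasure unitInterval G.D × BoundedMeasure (unitInterval × unitInterval) G.D → ℝ≥0∞,
    SatisfiesLDP (fun n => Measure.pi fun _ : G.V n => (volume : Measure unitInterval))
      (fun n => G.measurePair n) (fun n => (Fintype.card (G.V n) : ℝ)) J

/-! ### Quotients -/

/-- The space `[0,D]^{(k+1) × k}` of pairs `(x, X)` with `x ∈ [0,D]^k` and `X ∈ [0,D]^{k × k}`. -/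
abbrev QuotientSpace (k : ℕ) (D : ℝ≥0) : Type :=
  (Fin k → Set.Icc (0 : ℝ) D) × (Fin k → Fin k → Set.Icc (0 : ℝ) D)

open Classical in
/-- `x_i(σ) = |V_i| / |V|` where `V_i = σ⁻¹(i)`. -/
def quotientNode {V : Type u} [Fintype V] {k : ℕ} (σ : V → Fin k) (i : Fin k) : ℝ :=
  (Finset.univ.filter fun w => σ w = i).card / Fintype.card V

open Classical in
/-- `X_{ij}(σ) = |{u ∈ V_i, v ∈ V_j : u ∼ v}| / |V|`, counting ordered pairs `(u, v)`. -/
def quotientEdge {V : Type u} [Fintype V] (G : SimpleGraph V) {k : ℕ} (σ : V → Fin k)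
    (i j : Fin k) : ℝ :=
  (Finset.univ.filter fun p : V × V => σ p.1 = i ∧ σ p.2 = j ∧ G.Adj p.1 p.2).card /
    Fintype.card V

theorem quotientNode_mem {V : Type u} [Fintype V] {k : ℕ} (σ : V → Fin k) (i : Fin k) {D : ℝ≥0}
    (hD : 1 ≤ D) : quotientNode σ i ∈ Set.Icc (0 : ℝ) D := by
  classical
  refine ⟨by unfold quotientNode; positivity, le_trans ?_ (by exact_mod_cast hD : (1 : ℝ) ≤ D)⟩
  refine div_le_one_of_le₀ ?_ (by positivity)
  exact_mod_cast Finset.card_le_univ _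

open Classical in
theorem quotientEdge_mem {V : Type u} [Fintype V] (G : SimpleGraph V) {k : ℕ} (σ : V → Fin k)
    (i j : Fin k) {D : ℝ≥0} (hD : ∀ w, (G.degree w : ℝ≥0) ≤ D) :
    quotientEdge G σ i j ∈ Set.Icc (0 : ℝ) D := by
  refine ⟨by unfold quotientEdge; positivity, ?_⟩
  have h1 : (Finset.univ.filter fun p : V × V => σ p.1 = i ∧ σ p.2 = j ∧ G.Adj p.1 p.2).card ≤
      ∑ w, G.degree w := by
    simp only [← SimpleGraph.card_neighborFinset_eq_degree]
    rw [← Finset.card_sigma]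
    refine Finset.card_le_card_of_injOn (fun p => ⟨p.1, p.2⟩) ?_ ?_
    · rintro ⟨a, b⟩ h
      simp only [Finset.coe_filter, Finset.mem_univ, true_and, Set.mem_ofPred_eq] at h
      simp [h.2.2]
    · rintro ⟨a, b⟩ _ ⟨c, d⟩ _ h
      simpa using h
  have h2 := card_inv_mul_le (fun w => (G.degree w : ℝ≥0)) D hD
  have h2' : (Fintype.card V : ℝ)⁻¹ * ∑ w, (G.degree w : ℝ) ≤ D := by exact_mod_cast h2
  refine le_trans ?_ h2'
  rw [quotientEdge, div_eq_inv_mul]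
  exact mul_le_mul_of_nonneg_left (by exact_mod_cast h1) (by positivity)

/-- The `k`-quotient `(x(σ), X(σ))` of the `n`-th graph of the sequence. -/
def SparseGraphSeq.quotient (G : SparseGraphSeq.{u}) (k n : ℕ) (σ : G.V n → Fin k) :
    QuotientSpace k G.D :=
  (fun i => ⟨quotientNode σ i, quotientNode_mem σ i G.one_le_D⟩,
   fun i j => ⟨quotientEdge (G.graph n) σ i j,
    quotientEdge_mem (G.graph n) σ i j (G.degree_le n)⟩)

/-- `J` is the rate function of the `k`-quotients: for a uniformly random coloring
`σ_n : V_n → [k]`, the random elements `(x(σ_n), X(σ_n))` of `[0,D]^{(k+1) × k}` satisfy the LDP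
with normalization `|V_n|` and rate function `J`. -/
def SparseGraphSeq.IsQuotientRate (G : SparseGraphSeq.{u}) (k : ℕ)
    (J : QuotientSpace k G.D → ℝ≥0∞) : Prop :=
  SatisfiesLDP (fun n => ProbabilityTheory.uniformOn (Set.univ : Set (G.V n → Fin k)))
    (fun n => G.quotient k n) (fun n => (Fintype.card (G.V n) : ℝ)) J

/-! ### Weighted target graphs, homomorphism numbers, right-convergence -/

/-- A weighted graph on `k` nodes, with node weights `α` and a symmetric matrix `A` of edge
weights (loops are allowed). -/
structure WeightedGraph (k : ℕ) where
  α : Fin k → ℝ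
  A : Fin k → Fin k → ℝ
  symm : ∀ i j, A i j = A j i

/-- Soft-core: all node weights and all edge weights are strictly positive. -/
def WeightedGraph.SoftCore {k : ℕ} (H : WeightedGraph k) : Prop :=
  (∀ i, 0 < H.α i) ∧ ∀ i j, 0 < H.A i j

open Classical in
/-- `hom(G, H) = ∑_σ ∏_u α_{σ(u)} ∏_{uv} A_{σ(u) σ(v)}`, with one factor for every (unoriented)
edge `uv` of `G`. -/
def weightedHom {V : Type u} [Fintype V] (G : SimpleGraph V) {k : ℕ} (H : WeightedGraph k) : ℝ :=
  ∑ σ : V → Fin k, (∏ w, H.α (σ w)) *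
    ∏ e ∈ G.edgeFinset, Sym2.lift ⟨fun a b => H.A (σ a) (σ b), fun a b => H.symm (σ a) (σ b)⟩ e

/-- Right-convergence: for every soft-core graph `H` the limit of `log hom(G_n, H) / |V_n|`
exists (in `ℝ`). -/
def SparseGraphSeq.RightConvergent (G : SparseGraphSeq.{u}) : Prop :=
  ∀ k : ℕ, 1 ≤ k → ∀ H : WeightedGraph k, H.SoftCore → ∃ L : ℝ,
    Tendsto (fun n => Real.log (weightedHom (G.graph n) H) / Fintype.card (G.V n)) atTop (𝓝 L)

/-- The energy functional
`E_H(x, X) = - ∑_i x_i log α_i - (1/2) ∑_{i,j} X_{ij} log A_{ij}`. -/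
def energy {k : ℕ} {D : ℝ≥0} (H : WeightedGraph k) (p : QuotientSpace k D) : ℝ :=
  -(∑ i, (p.1 i : ℝ) * Real.log (H.α i)) -
    (1 / 2) * ∑ i, ∑ j, (p.2 i j : ℝ) * Real.log (H.A i j)

/-- The entropy functional `S_k(x, X) = log k - J(x, X)` of a rate function `J`. -/
def entropy {k : ℕ} {D : ℝ≥0} (J : QuotientSpace k D → ℝ≥0∞) (p : QuotientSpace k D) : EReal :=
  ((Real.log k : ℝ) : EReal) - (J p : EReal)

end SparseGraph

end

/-!
Large deviations of the random measures pass to the quotients by a contraction principle, and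
from the quotients to homomorphism numbers by Varadhan's lemma.

Cut `[0, 1]` into `k` classes of length `1 / k`. Rounding independent uniform colors to their
classes gives a uniformly random map to `Fin k`, whose quotient is the image of `(ρ(σ), μ(σ))` under
evaluation on the classes `Bᵢ` and on the products `Bᵢ × Bⱼ` (`bucketQuotient`). This evaluation
is not continuous for the weak topology, but it is continuous at measures that do not charge the
boundaries of these sets. Every pair of finite rate has this property (`fst_null_of_rate_ne_top`,
`snd_null_of_rate_ne_top`): near a pair with `ρ(T) > 0` or `μ(T × [0, 1]) > 0` for a Lebesgue-null
set `T`, a positive fraction of the vertices must be colored from an arbitrarily small neighborhood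
of `T`, because the degrees are bounded. By a union bound over vertex sets this has probability at
most `exp (-K |V|)` for any given `K`, once the neighborhood is small enough
(`pi_volume_card_lt_le`). Continuity at the points of finite rate suffices for the contraction
principle (`SatisfiesLDP.contraction`). Uniqueness of the rate function holds in every regular
space (`SatisfiesLDP.rate_unique`).

Each summand of `hom(G_n, H)` equals `exp (-|V| E_H)` at the quotient of the coloring, so that
`hom(G_n, H)` is the expectation of `exp (-|V| (E_H - log k))` over uniformly random maps. As the
energy is bounded and continuous, `SatisfiesLDP.varadhan` evaluates the limit.
-/

noncomputable section

namespace SparseGraph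

/-! ### The regularized rate function of an image -/

/-- The lower semicontinuous regularization of `y ↦ ⨅ s ∈ F ⁻¹' {y}, I s`. -/
def contractedRate {S T : Type*} [TopologicalSpace T] (F : S → T) (I : S → ℝ≥0∞) (y : T) : ℝ≥0∞ :=
  ⨆ U : {U : Set T // IsOpen U ∧ y ∈ U}, ⨅ s ∈ F ⁻¹' U.1, I s

theorem contractedRate_apply_le {S T : Type*} [TopologicalSpace T] (F : S → T) (I : S → ℝ≥0∞)
    (s : S) : contractedRate F I (F s) ≤ I s :=
  iSup_le fun U => iInf₂_le s U.2.2

theorem le_contractedRate {S T : Type*} [TopologicalSpace T] (F : S → T) (I : S → ℝ≥0∞)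
    {U : Set T} (hU : IsOpen U) {y : T} (hy : y ∈ U) :
    ⨅ s ∈ F ⁻¹' U, I s ≤ contractedRate F I y :=
  le_iSup (fun U : {U : Set T // IsOpen U ∧ y ∈ U} => ⨅ s ∈ F ⁻¹' U.1, I s) ⟨U, hU, hy⟩

theorem lowerSemicontinuous_contractedRate {S T : Type*} [TopologicalSpace T] (F : S → T)
    (I : S → ℝ≥0∞) : LowerSemicontinuous (contractedRate F I) := by
  intro y c hc
  obtain ⟨U, hU⟩ := lt_iSup_iff.1 hc
  filter_upwards [U.2.1.mem_nhds U.2.2] with z hz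
  exact hU.trans_le (le_contractedRate F I U.2.1 hz)

/-! ### Exponential bounds equivalent to the large deviations principle -/

theorem coe_le_log_div_iff {θ : ℝ} (hθ : 0 < θ) (a : ℝ) (p : ℝ≥0∞) :
    (a : EReal) ≤ ENNReal.log p / (θ : EReal) ↔ ENNReal.ofReal (Real.exp (a * θ)) ≤ p := by
  rw [EReal.le_div_iff_mul_le (by exact_mod_cast hθ) (EReal.coe_ne_top _), ← EReal.coe_mul,
    ← EReal.exp_le_exp_iff, ENNReal.exp_log, EReal.exp_coe]

theorem log_div_le_coe_iff {θ : ℝ} (hθ : 0 < θ) (a : ℝ) (p : ℝ≥0∞) :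
    ENNReal.log p / (θ : EReal) ≤ a ↔ p ≤ ENNReal.ofReal (Real.exp (a * θ)) := by
  rw [EReal.div_le_iff_le_mul (by exact_mod_cast hθ) (EReal.coe_ne_top _), mul_comm,
    ← EReal.coe_mul, ← EReal.exp_le_exp_iff, ENNReal.exp_log, EReal.exp_coe]

section LDP

variable {S : Type v} [TopologicalSpace S] {Ω : ℕ → Type u} [∀ n, MeasurableSpace (Ω n)]
  {P : ∀ n, Measure (Ω n)} {X : ∀ n, Ω n → S} {θ : ℕ → ℝ} {I : S → ℝ≥0∞}

/-- The lower bound at a single point of an open set, in exponential form. -/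
theorem SatisfiesLDP.eventually_le (h : SatisfiesLDP P X θ I) {U : Set S} (hU : IsOpen U) {s : S}
    (hs : s ∈ U) {c : ℝ} (hc : (I s : EReal) < c) :
    ∀ᶠ n in atTop, ENNReal.ofReal (Real.exp (-c * θ n)) ≤ P n (X n ⁻¹' U) := by
  have h1 := h.lower_bound U
  rw [hU.interior_eq] at h1
  have h2 : ((-c : ℝ) : EReal) < -(⨅ s ∈ U, (I s : EReal)) := by
    rw [EReal.coe_neg, EReal.neg_lt_neg_iff]
    exact (iInf₂_le s hs).trans_lt hc
  filter_upwards [eventually_lt_of_lt_liminf (h2.trans_le h1)] with n hn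
  exact (coe_le_log_div_iff (h.rate_pos n) _ _).1 hn.le

/-- The upper bound for a closed set, in exponential form. -/
theorem SatisfiesLDP.eventually_ge (h : SatisfiesLDP P X θ I) {C : Set S} (hC : IsClosed C)
    {c c' : ℝ} (hc : c < c') (hI : ∀ s ∈ C, (c' : EReal) ≤ I s) :
    ∀ᶠ n in atTop, P n (X n ⁻¹' C) ≤ ENNReal.ofReal (Real.exp (-c * θ n)) := by
  have h1 := h.upper_bound C
  rw [hC.closure_eq] at h1
  have h2 : -(⨅ s ∈ C, (I s : EReal)) < ((-c : ℝ) : EReal) := by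
    rw [EReal.coe_neg, EReal.neg_lt_neg_iff]
    exact (EReal.coe_lt_coe_iff.2 hc).trans_le (le_iInf₂ hI)
  filter_upwards [eventually_lt_of_limsup_lt (h1.trans_lt h2)] with n hn
  exact (log_div_le_coe_iff (h.rate_pos n) _ _).1 hn.le

/-- The converse of `SatisfiesLDP.eventually_le` and `SatisfiesLDP.eventually_ge`. -/
theorem SatisfiesLDP.of_eventually (hP : ∀ n, IsProbabilityMeasure (P n)) (hθ : ∀ n, 0 < θ n)
    (hθ' : Tendsto θ atTop atTop) (hI : LowerSemicontinuous I)
    (hlow : ∀ U : Set S, IsOpen U → ∀ s ∈ U, ∀ c : ℝ, (I s : EReal) < c →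
      ∀ᶠ n in atTop, ENNReal.ofReal (Real.exp (-c * θ n)) ≤ P n (X n ⁻¹' U))
    (hup : ∀ C : Set S, IsClosed C → ∀ c c' : ℝ, c < c' → (∀ s ∈ C, (c' : EReal) ≤ I s) →
      ∀ᶠ n in atTop, P n (X n ⁻¹' C) ≤ ENNReal.ofReal (Real.exp (-c * θ n))) :
    SatisfiesLDP P X θ I where
  isProb := hP
  rate_pos := hθ
  rate_tendsto := hθ'
  lowerSemicontinuous := hI
  lower_bound A := by
    refine EReal.ge_of_forall_gt_iff_ge.1 fun z hz => ?_
    have hz' : (⨅ s ∈ interior A, (I s : EReal)) < ((-z : ℝ) : EReal) := by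
      rw [EReal.coe_neg]
      exact EReal.lt_neg_comm.1 hz
    obtain ⟨s, hs, hsz⟩ : ∃ s ∈ interior A, (I s : EReal) < ((-z : ℝ) : EReal) := by
      simpa only [iInf_lt_iff, exists_prop] using hz'
    refine le_liminf_of_le (by isBoundedDefault) ?_
    filter_upwards [hlow _ isOpen_interior s hs _ hsz] with n hn
    exact (coe_le_log_div_iff (hθ n) _ _).2 (by simpa using hn)
  upper_bound A := by
    refine EReal.le_of_forall_lt_iff_le.1 fun z hz => ?_
    obtain ⟨w, hw1, hw2⟩ := EReal.lt_iff_exists_real_btwn.1 hz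
    have hw' : ((-w : ℝ) : EReal) ≤ ⨅ s ∈ closure A, (I s : EReal) := by
      rw [EReal.coe_neg]
      exact (EReal.neg_lt_comm.1 hw1).le
    refine limsup_le_of_le (by isBoundedDefault) ?_
    filter_upwards [hup _ isClosed_closure (-z) (-w)
      (neg_lt_neg (EReal.coe_lt_coe_iff.1 hw2)) fun s hs => hw'.trans (iInf₂_le s hs)] with n hn
    exact (log_div_le_coe_iff (hθ n) _ _).2 (by simpa using hn)

/-! ### Uniqueness of the rate function -/

/-- If `I' s < I s`, then by semicontinuity `I` exceeds `I' s` by a margin on a closed neighborhood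
of `s`, where the upper bound for `I` contradicts the lower bound for `I'`. -/
theorem SatisfiesLDP.rate_le [RegularSpace S] {I' : S → ℝ≥0∞} (h : SatisfiesLDP P X θ I)
    (h' : SatisfiesLDP P X θ I') : I ≤ I' := by
  intro s
  by_contra! hlt
  obtain ⟨a, ha1, ha2⟩ := ENNReal.lt_iff_exists_nnreal_btwn.1 hlt
  obtain ⟨b, hb1, hb2⟩ := ENNReal.lt_iff_exists_nnreal_btwn.1 ha2
  have hab : (a : ℝ) < b := by exact_mod_cast hb1
  obtain ⟨C, hC, hCc, hCI⟩ := (closed_nhds_basis s).mem_iff.1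
    (h.lowerSemicontinuous s _ hb2) |>.imp fun C hC => (⟨hC.1.1, hC.1.2, hC.2⟩ :
      C ∈ 𝓝 s ∧ IsClosed C ∧ C ⊆ _)
  have e1 := h'.eventually_le isOpen_interior (mem_interior_iff_mem_nhds.2 hC) (c := a)
    (by rwa [← EReal.coe_nnreal_eq_coe_real, EReal.coe_ennreal_lt_coe_ennreal_iff])
  have e2 := h.eventually_ge hCc (c := (a + b) / 2) (c' := b) (by linarith) fun t ht => by
    have : (b : ℝ≥0∞) < I t := hCI ht
    rw [← EReal.coe_nnreal_eq_coe_real, EReal.coe_ennreal_le_coe_ennreal_iff]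
    exact this.le
  obtain ⟨n, h1, h2⟩ := (e1.and e2).exists
  have h3 := (h1.trans (measure_mono (Set.preimage_mono interior_subset))).trans h2
  rw [ENNReal.ofReal_le_ofReal_iff (Real.exp_pos _).le, Real.exp_le_exp] at h3
  nlinarith [h.rate_pos n]

/-- In a regular space the rate function is determined by the random elements. -/
theorem SatisfiesLDP.rate_unique [RegularSpace S] {I' : S → ℝ≥0∞} (h : SatisfiesLDP P X θ I)
    (h' : SatisfiesLDP P X θ I') : I = I' :=
  le_antisymm (h.rate_le h') (h'.rate_le h)

/-! ### Contraction by maps that are continuous at the points of finite rate -/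

/-- The contraction principle for a map that need only be continuous at the points of finite rate.
Replacing the rate of the image by its lower semicontinuous regularization does not change infima
over open sets and does not increase those over closed sets, so that no compactness of the
sublevel sets of `I` is needed. -/
theorem SatisfiesLDP.contraction {T : Type*} [TopologicalSpace T] (h : SatisfiesLDP P X θ I)
    (F : S → T) (hF : ∀ s, I s ≠ ⊤ → ContinuousAt F s)
    {Ω' : ℕ → Type*} [∀ n, MeasurableSpace (Ω' n)] {Q : ∀ n, Measure (Ω' n)}
    (hQ : ∀ n, IsProbabilityMeasure (Q n)) {Y : ∀ n, Ω' n → T}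
    (hY : ∀ n (A : Set T), Q n (Y n ⁻¹' A) = P n (X n ⁻¹' (F ⁻¹' A))) :
    SatisfiesLDP Q Y θ (contractedRate F I) := by
  refine .of_eventually hQ h.rate_pos h.rate_tendsto (lowerSemicontinuous_contractedRate F I)
    (fun U hU y hy c hc => ?_) (fun C hC c c' hc hI => ?_)
  · have h1 : ∃ s, F s ∈ U ∧ (I s : EReal) < c := by
      by_contra! hcon
      have hy' : (((⨅ s ∈ F ⁻¹' U, I s : ℝ≥0∞)) : EReal) < c :=
        (EReal.coe_ennreal_le_coe_ennreal_iff.2 (le_contractedRate F I hU hy)).trans_lt hc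
      have hc0 : 0 ≤ c := by
        have : (0 : EReal) ≤ c := (EReal.coe_ennreal_nonneg _).trans hc.le
        exact_mod_cast this
      have hc1 : ((ENNReal.ofReal c : ℝ≥0∞) : EReal) = c := by
        rw [EReal.coe_ennreal_ofReal, max_eq_left hc0]
      rw [← hc1, EReal.coe_ennreal_lt_coe_ennreal_iff] at hy'
      refine hy'.not_ge (le_iInf₂ fun s hs => ?_)
      have := hcon s hs
      rwa [← hc1, EReal.coe_ennreal_le_coe_ennreal_iff] at this
    obtain ⟨s, hs, hsc⟩ := h1
    have hsfin : I s ≠ ⊤ := fun h0 => by simp [h0] at hsc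
    have hint : s ∈ interior (F ⁻¹' U) :=
      mem_interior_iff_mem_nhds.2 (hF s hsfin (hU.mem_nhds hs))
    filter_upwards [h.eventually_le isOpen_interior hint hsc] with n hn
    rw [hY]
    exact hn.trans (measure_mono (Set.preimage_mono interior_subset))
  · have h1 : ∀ s ∈ closure (F ⁻¹' C), (c' : EReal) ≤ I s := by
      intro s hs
      by_cases hfin : I s = ⊤
      · simp [hfin]
      · have : F s ∈ C := by
          have := mem_closure_image (hF s hfin) hs
          exact closure_minimal (Set.image_preimage_subset F C) hC this
        exact (hI _ this).trans
          (EReal.coe_ennreal_le_coe_ennreal_iff.2 (contractedRate_apply_le F I s))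
    filter_upwards [h.eventually_ge isClosed_closure hc h1] with n hn
    rw [hY]
    exact (measure_mono (Set.preimage_mono subset_closure)).trans hn

end LDP

section Varadhan

variable {S : Type v} [TopologicalSpace S] {Ω : ℕ → Type u} [∀ n, MeasurableSpace (Ω n)]
  {P : ∀ n, Measure (Ω n)} {X : ∀ n, Ω n → S} {θ : ℕ → ℝ} {I : S → ℝ≥0∞}

/-! ### Varadhan's lemma for bounded continuous functions -/

/-- Otherwise the upper bound for the whole space would force `P n univ < 1`. -/
theorem SatisfiesLDP.exists_rate_lt_top (h : SatisfiesLDP P X θ I) : ∃ s, I s < ⊤ := by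
  by_contra! hcon
  have e := h.eventually_ge isClosed_univ (c := 1) (c' := 2) (by norm_num) fun s _ => by
    simp [top_le_iff.1 (hcon s)]
  obtain ⟨n, hn⟩ := e.exists
  have := h.isProb n
  rw [Set.preimage_univ, measure_univ, ENNReal.one_le_ofReal, Real.one_le_exp_iff] at hn
  linarith [h.rate_pos n]

theorem SatisfiesLDP.exists_coe_eq_iInf (h : SatisfiesLDP P X θ I) {f : S → ℝ} {B : ℝ}
    (hB : ∀ s, |f s| ≤ B) : ∃ F : ℝ, (F : EReal) = ⨅ s, ((f s : EReal) + (I s : EReal)) := by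
  refine ⟨_, EReal.coe_toReal ?_ ?_⟩
  · obtain ⟨s, hs⟩ := h.exists_rate_lt_top
    refine ((iInf_le _ s).trans_lt (EReal.add_lt_top (EReal.coe_ne_top _) ?_)).ne
    simpa using hs.ne
  · refine ((EReal.bot_lt_coe (-B)).trans_le (le_iInf fun s => ?_)).ne'
    have h1 : ((-B : ℝ) : EReal) ≤ f s := EReal.coe_le_coe_iff.2 (neg_le_of_abs_le (hB s))
    simpa using add_le_add h1 (EReal.coe_ennreal_nonneg (I s))

/-- The lower bound in Varadhan's lemma: it suffices to integrate over the event that `f (X n)`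
does not exceed by much its value at a point that is nearly optimal. -/
theorem SatisfiesLDP.eventually_le_lintegral (h : SatisfiesLDP P X θ I) {f : S → ℝ}
    (hf : Continuous f) (hm : ∀ n, Measurable fun ω => f (X n ω)) {F c : ℝ}
    (hF : (F : EReal) = ⨅ s, ((f s : EReal) + (I s : EReal))) (hc : F < c) :
    ∀ᶠ n in atTop, ENNReal.ofReal (Real.exp (-c * θ n)) ≤
      ∫⁻ ω, ENNReal.ofReal (Real.exp (-(θ n * f (X n ω)))) ∂P n := by
  obtain ⟨s, hs⟩ : ∃ s, (f s : EReal) + (I s : EReal) < c := by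
    rw [← iInf_lt_iff, ← hF]
    exact EReal.coe_lt_coe_iff.2 hc
  have hI : (I s : EReal) < ((c - f s : ℝ) : EReal) := by
    rw [EReal.coe_sub]
    exact EReal.lt_sub_iff_add_lt (by simp) (by simp) |>.2 (by rwa [add_comm])
  obtain ⟨d, hd1, hd2⟩ := EReal.lt_iff_exists_real_btwn.1 hI
  have hd2' : d < c - f s := EReal.coe_lt_coe_iff.1 hd2
  have hU : IsOpen (f ⁻¹' Set.Iio (c - d)) := isOpen_Iio.preimage hf
  filter_upwards [h.eventually_le hU (s := s) (by simp; linarith) hd1] with n hn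
  have hθ := h.rate_pos n
  set U := X n ⁻¹' (f ⁻¹' Set.Iio (c - d)) with hUdef
  have hUm : MeasurableSet U := hm n measurableSet_Iio
  calc ENNReal.ofReal (Real.exp (-c * θ n))
      = ENNReal.ofReal (Real.exp (-(θ n * (c - d)))) * ENNReal.ofReal (Real.exp (-d * θ n)) := by
        rw [← ENNReal.ofReal_mul (Real.exp_pos _).le, ← Real.exp_add]
        congr 2
        ring
    _ ≤ ENNReal.ofReal (Real.exp (-(θ n * (c - d)))) * P n U := by gcongr
    _ = ∫⁻ _ in U, ENNReal.ofReal (Real.exp (-(θ n * (c - d)))) ∂P n := by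
        rw [setLIntegral_const]
    _ ≤ ∫⁻ ω in U, ENNReal.ofReal (Real.exp (-(θ n * f (X n ω)))) ∂P n := by
        refine setLIntegral_mono' hUm fun ω hω => ?_
        have : f (X n ω) < c - d := hω
        gcongr
    _ ≤ _ := setLIntegral_le_lintegral _ _

/-- The upper bound in Varadhan's lemma: the range of `f` is cut into finitely many slabs on each
of which `f` oscillates by at most `ε`. -/
theorem SatisfiesLDP.eventually_lintegral_le (h : SatisfiesLDP P X θ I) {f : S → ℝ}
    (hf : Continuous f) {B : ℝ} (hB : ∀ s, |f s| ≤ B)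
    (hm : ∀ n, Measurable fun ω => f (X n ω)) {F c : ℝ}
    (hF : (F : EReal) = ⨅ s, ((f s : EReal) + (I s : EReal))) (hc : c < F) :
    ∀ᶠ n in atTop, ∫⁻ ω, ENNReal.ofReal (Real.exp (-(θ n * f (X n ω)))) ∂P n ≤
      ENNReal.ofReal (Real.exp (-c * θ n)) := by
  -- One `ε` is lost to the width of a slab, one to the upper bound, one to the number of slabs.
  set ε := (F - c) / 3 with hε
  have hε0 : 0 < ε := by rw [hε]; linarith
  obtain ⟨N, hN⟩ := exists_nat_gt (2 * B / ε)
  rw [div_lt_iff₀ hε0] at hN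
  let C : Fin N → Set S := fun m => f ⁻¹' Set.Icc (-B + m * ε) (-B + (m + 1) * ε)
  have hCc : ∀ m, IsClosed (C m) := fun m => isClosed_Icc.preimage hf
  have hcover : ∀ s, ∃ m, s ∈ C m := by
    intro s
    have h1 := abs_le.1 (hB s)
    have h0 : 0 ≤ (f s + B) / ε := div_nonneg (by linarith) hε0.le
    refine ⟨⟨⌊(f s + B) / ε⌋₊, ?_⟩, ?_, ?_⟩
    · rw [Nat.floor_lt h0, div_lt_iff₀ hε0]
      linarith
    · have := Nat.floor_le h0
      rw [le_div_iff₀ hε0] at this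
      simp only
      linarith
    · have := (Nat.lt_floor_add_one ((f s + B) / ε)).le
      rw [div_le_iff₀ hε0] at this
      simp only
      linarith
  have hbound : ∀ m : Fin N, ∀ᶠ n in atTop, P n (X n ⁻¹' C m) ≤
      ENNReal.ofReal (Real.exp (-(F + B - (m + 1) * ε - ε) * θ n)) := by
    intro m
    refine h.eventually_ge (hCc m) (c' := F + B - (m + 1) * ε) (by linarith) fun s hs => ?_
    have h1 : (F : EReal) ≤ f s + I s := hF ▸ iInf_le _ s
    have h2 : ((F - f s : ℝ) : EReal) ≤ I s := by
      rw [EReal.coe_sub]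
      exact EReal.sub_le_of_le_add' h1
    refine le_trans (EReal.coe_le_coe_iff.2 ?_) h2
    have := hs.2
    linarith
  have hlarge : ∀ᶠ n in atTop, Real.log N / ε ≤ θ n := h.rate_tendsto.eventually_ge_atTop _
  filter_upwards [eventually_all.2 hbound, hlarge] with n hn hn'
  have hθ := h.rate_pos n
  have hslab : ∀ m : Fin N,
      ∫⁻ ω in X n ⁻¹' C m, ENNReal.ofReal (Real.exp (-(θ n * f (X n ω)))) ∂P n ≤
        ENNReal.ofReal (Real.exp (-(F - 2 * ε) * θ n)) := by
    intro m
    have hCm : MeasurableSet (X n ⁻¹' C m) := hm n measurableSet_Icc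
    calc _ ≤ ∫⁻ _ in X n ⁻¹' C m, ENNReal.ofReal (Real.exp (-(θ n * (-B + m * ε)))) ∂P n := by
          refine setLIntegral_mono' hCm fun ω hω => ?_
          have : -B + m * ε ≤ f (X n ω) := hω.1
          gcongr
      _ = ENNReal.ofReal (Real.exp (-(θ n * (-B + m * ε)))) * P n (X n ⁻¹' C m) := by
          rw [setLIntegral_const]
      _ ≤ ENNReal.ofReal (Real.exp (-(θ n * (-B + m * ε)))) *
            ENNReal.ofReal (Real.exp (-(F + B - (m + 1) * ε - ε) * θ n)) := by
          gcongr
          exact hn m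
      _ = _ := by
          rw [← ENNReal.ofReal_mul (Real.exp_pos _).le, ← Real.exp_add]
          congr 2
          ring
  have huniv : (⋃ m, X n ⁻¹' C m) = Set.univ :=
    Set.eq_univ_of_forall fun ω => Set.mem_iUnion.2 (hcover (X n ω))
  rw [← setLIntegral_univ, ← huniv]
  refine (lintegral_iUnion_le _ _).trans ?_
  rw [tsum_fintype]
  refine (Finset.sum_le_card_nsmul _ _ _ fun m _ => hslab m).trans ?_
  rw [Finset.card_univ, Fintype.card_fin, nsmul_eq_mul, ← ENNReal.ofReal_natCast,
    ← ENNReal.ofReal_mul (Nat.cast_nonneg N)]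
  refine ENNReal.ofReal_le_ofReal ?_
  have hNle : (N : ℝ) ≤ Real.exp (ε * θ n) := by
    rcases Nat.eq_zero_or_pos N with h0 | h0
    · simp [h0, (Real.exp_pos _).le]
    · rw [← Real.log_le_iff_le_exp (by exact_mod_cast h0)]
      rw [div_le_iff₀ hε0] at hn'
      linarith
  calc (N : ℝ) * Real.exp (-(F - 2 * ε) * θ n)
      ≤ Real.exp (ε * θ n) * Real.exp (-(F - 2 * ε) * θ n) := by gcongr
    _ = Real.exp (-c * θ n) := by
      rw [← Real.exp_add, show c = F - 3 * ε by rw [hε]; ring]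
      congr 1
      ring

/-- Varadhan's lemma for a bounded continuous function. -/
theorem SatisfiesLDP.varadhan (h : SatisfiesLDP P X θ I) {f : S → ℝ}
    (hf : Continuous f) {B : ℝ} (hB : ∀ s, |f s| ≤ B)
    (hm : ∀ n, Measurable fun ω => f (X n ω)) {Z : ℕ → ℝ} (hZ : ∀ n, 0 < Z n)
    (hZeq : ∀ n, ENNReal.ofReal (Z n) =
      ∫⁻ ω, ENNReal.ofReal (Real.exp (-(θ n * f (X n ω)))) ∂P n) :
    ∃ F : ℝ, Tendsto (fun n => -(1 / θ n * Real.log (Z n))) atTop (𝓝 F) ∧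
      (F : EReal) = ⨅ s, ((f s : EReal) + (I s : EReal)) := by
  obtain ⟨F, hF⟩ := h.exists_coe_eq_iInf hB
  refine ⟨F, tendsto_order.2 ⟨fun c hc => ?_, fun c hc => ?_⟩, hF⟩
  · obtain ⟨d, hd1, hd2⟩ := exists_between hc
    filter_upwards [h.eventually_lintegral_le hf hB hm hF hd2] with n hn
    have hθ := h.rate_pos n
    rw [← hZeq, ENNReal.ofReal_le_ofReal_iff (Real.exp_pos _).le,
      ← Real.log_le_iff_le_exp (hZ n)] at hn
    refine hd1.trans_le ?_
    rw [one_div, ← div_eq_inv_mul, le_neg, div_le_iff₀ hθ]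
    exact hn
  · obtain ⟨d, hd1, hd2⟩ := exists_between hc
    filter_upwards [h.eventually_le_lintegral hf hm hF hd1] with n hn
    have hθ := h.rate_pos n
    rw [← hZeq, ENNReal.ofReal_le_ofReal_iff (hZ n).le,
      ← Real.le_log_iff_exp_le (hZ n)] at hn
    refine lt_of_le_of_lt ?_ hd2
    rw [one_div, ← div_eq_inv_mul, neg_le, le_div_iff₀ hθ]
    exact hn

end Varadhan

/-! ### Weak convergence of finite measures on closed, open and null-frontier sets -/

section Weak

variable {E : Type*} [MeasurableSpace E] [TopologicalSpace E] [HasOuterApproxClosed E]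
  [OpensMeasurableSpace E] {ι : Type*} {L : Filter ι} {μ : FiniteMeasure E}
  {μs : ι → FiniteMeasure E}

theorem eventually_measureReal_lt (h : Tendsto μs L (𝓝 μ)) {F : Set E} (hF : IsClosed F) {a : ℝ}
    (ha : (μ : Measure E).real F < a) : ∀ᶠ i in L, (μs i : Measure E).real F < a := by
  have h1 := FiniteMeasure.limsup_measure_closed_le_of_tendsto h hF
  have h2 : (μ : Measure E) F < ENNReal.ofReal a :=
    (ENNReal.lt_ofReal_iff_toReal_lt (measure_ne_top _ _)).2 ha
  filter_upwards [eventually_lt_of_limsup_lt (h1.trans_lt h2)] with i hi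
  exact (ENNReal.lt_ofReal_iff_toReal_lt (measure_ne_top _ _)).1 hi

theorem eventually_lt_measureReal (h : Tendsto μs L (𝓝 μ)) {U : Set E} (hU : IsOpen U) {a : ℝ}
    (ha : a < (μ : Measure E).real U) : ∀ᶠ i in L, a < (μs i : Measure E).real U := by
  have hcompl : ∀ ν : FiniteMeasure E, (ν : Measure E).real U =
      ν.mass - (ν : Measure E).real Uᶜ := fun ν => by
    rw [measureReal_compl hU.measurableSet, measureReal_def _ Set.univ,
      ← FiniteMeasure.ennreal_mass, ENNReal.coe_toReal, sub_sub_cancel]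
  set ε := ((μ : Measure E).real U - a) / 2 with hε
  have hε0 : 0 < ε := by rw [hε]; linarith
  have hmass : Tendsto (fun i => ((μs i).mass : ℝ)) L (𝓝 (μ.mass : ℝ)) :=
    NNReal.tendsto_coe.2 h.mass
  filter_upwards [hmass.eventually_const_lt (sub_lt_self _ hε0), eventually_measureReal_lt h
    hU.isClosed_compl (lt_add_of_pos_right _ hε0)] with i h1 h2
  have h3 := hcompl μ
  rw [hcompl]
  linarith

theorem tendsto_measureReal_of_null_frontier (h : Tendsto μs L (𝓝 μ)) {A : Set E}
    (hA : (μ : Measure E) (frontier A) = 0) :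
    Tendsto (fun i => (μs i : Measure E).real A) L (𝓝 ((μ : Measure E).real A)) := by
  refine tendsto_order.2 ⟨fun a ha => ?_, fun a ha => ?_⟩
  · rw [Measure.real, ← measure_interior_of_null_frontier hA] at ha
    filter_upwards [eventually_lt_measureReal h isOpen_interior ha] with i hi
    exact hi.trans_le (measureReal_mono interior_subset)
  · rw [Measure.real, ← measure_closure_of_null_frontier hA] at ha
    filter_upwards [eventually_measureReal_lt h isClosed_closure ha] with i hi
    exact (measureReal_mono subset_closure).trans_lt hi

end Weak

/-! ### The measures of a coloring evaluated on sets -/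

theorem toMeasure_pointMass {E : Type*} [MeasurableSpace E] (x : E) :
    (pointMass x : Measure E) = Measure.dirac x := rfl

theorem finset_sum_real {E : Type*} [MeasurableSpace E] {ι : Type*} (s : Finset ι)
    (f : ι → FiniteMeasure E) (A : Set E) :
    ((∑ i ∈ s, f i : FiniteMeasure E) : Measure E).real A = ∑ i ∈ s, (f i : Measure E).real A := by
  rw [FiniteMeasure.toMeasure_sum]
  simp [measureReal_def, ENNReal.toReal_sum]

open Classical in
theorem pointMass_real {E : Type*} [MeasurableSpace E] (x : E) {A : Set E} (hA : MeasurableSet A) :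
    (pointMass x : Measure E).real A = if x ∈ A then 1 else 0 := by
  rw [toMeasure_pointMass, measureReal_def, Measure.dirac_apply' _ hA, Set.indicator_apply]
  split_ifs <;> simp

open Classical in
theorem rhoMeasure_real {V : Type u} [Fintype V] (σ : V → unitInterval) {A : Set unitInterval}
    (hA : MeasurableSet A) : (rhoMeasure σ : Measure unitInterval).real A =
      (Finset.univ.filter fun w => σ w ∈ A).card / Fintype.card V := by
  rw [rhoMeasure, FiniteMeasure.toMeasure_smul, measureReal_nnreal_smul_apply, finset_sum_real]
  simp [pointMass_real _ hA, div_eq_inv_mul]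

open Classical in
theorem muMeasure_real {V : Type u} [Fintype V] (G : SimpleGraph V) (σ : V → unitInterval)
    {A : Set (unitInterval × unitInterval)} (hA : MeasurableSet A) :
    (muMeasure G σ : Measure (unitInterval × unitInterval)).real A =
      (Finset.univ.filter fun p : V × V => (σ p.1, σ p.2) ∈ A ∧ G.Adj p.1 p.2).card /
        Fintype.card V := by
  rw [muMeasure, FiniteMeasure.toMeasure_smul, measureReal_nnreal_smul_apply, finset_sum_real,
    div_eq_inv_mul, Finset.card_filter, Fintype.sum_prod_type]
  rw [NNReal.coe_inv, NNReal.coe_natCast, Nat.cast_sum]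
  congr 1
  refine Finset.sum_congr rfl fun w _ => ?_
  rw [finset_sum_real, SimpleGraph.neighborFinset_eq_filter, Finset.sum_filter, Nat.cast_sum]
  simp [pointMass_real _ hA, ← ite_and, and_comm]

/-! ### Few vertices are colored from a set of small measure -/

open Classical in
/-- Union bound over the set of vertices whose color lies in `W`. -/
theorem pi_volume_card_lt_le {V : Type u} [Fintype V] {W : Set unitInterval} {M c : ℝ} (hM : 0 ≤ M)
    (hW : volume W ≤ ENNReal.ofReal (Real.exp (-M))) :
    (Measure.pi fun _ : V => (volume : Measure unitInterval))
      {σ | c * Fintype.card V < (Finset.univ.filter fun w => σ w ∈ W).card} ≤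
      ENNReal.ofReal (Real.exp (-(M * c - Real.log 2) * Fintype.card V)) := by
  set N : ℕ := Fintype.card V with hN
  -- `T` collects the possible large sets of vertices whose colors all lie in `W`.
  let T : Finset (Finset V) := Finset.univ.filter fun A => c * N < A.card
  have hsub : {σ : V → unitInterval | c * N < (Finset.univ.filter fun w => σ w ∈ W).card} ⊆
      ⋃ A ∈ T, Set.univ.pi fun w => if w ∈ A then W else Set.univ := by
    intro σ hσ
    refine Set.mem_biUnion (x := Finset.univ.filter fun w => σ w ∈ W)
      (by simpa [T] using hσ) fun w _ => ?_
    by_cases hw : σ w ∈ W <;> simp [hw]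
  refine (measure_mono hsub).trans ((measure_biUnion_finset_le _ _).trans ?_)
  have hA : ∀ A ∈ T, (Measure.pi fun _ : V => (volume : Measure unitInterval))
      (Set.univ.pi fun w => if w ∈ A then W else Set.univ) ≤
        ENNReal.ofReal (Real.exp (-(M * c) * N)) := by
    intro A hA
    have hA' : c * N < A.card := by simpa [T] using hA
    rw [Measure.pi_pi]
    calc ∏ w, volume (if w ∈ A then W else Set.univ) = volume W ^ A.card := by
          simp [apply_ite]
      _ ≤ ENNReal.ofReal (Real.exp (-M)) ^ A.card := by gcongr
      _ = ENNReal.ofReal (Real.exp (A.card * -M)) := by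
          rw [← ENNReal.ofReal_pow (Real.exp_pos _).le, ← Real.exp_nat_mul]
      _ ≤ _ := by
          refine ENNReal.ofReal_le_ofReal (Real.exp_le_exp.2 ?_)
          nlinarith [mul_le_mul_of_nonneg_left hA'.le hM]
  refine (Finset.sum_le_card_nsmul _ _ _ hA).trans ?_
  have hT : T.card ≤ 2 ^ N := (Finset.card_le_univ T).trans (by simp [hN])
  rw [nsmul_eq_mul, ← ENNReal.ofReal_natCast, ← ENNReal.ofReal_mul (Nat.cast_nonneg _)]
  refine ENNReal.ofReal_le_ofReal ?_
  calc (T.card : ℝ) * Real.exp (-(M * c) * N) ≤ (2 : ℝ) ^ N * Real.exp (-(M * c) * N) := by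
        gcongr
        exact_mod_cast hT
    _ = Real.exp (-(M * c - Real.log 2) * N) := by
        rw [show -(M * c - Real.log 2) * N = N * Real.log 2 + -(M * c) * N by ring, Real.exp_add,
          Real.exp_nat_mul, Real.exp_log two_pos]

/-! ### Measures of finite rate do not charge null sets of colors -/

open Classical in
/-- If every neighborhood `W` of a Lebesgue-null set of colors yields a neighborhood of `s` that can
only be visited when a positive fraction of the vertices has its color in `W`, then `s` has
infinite rate. -/
theorem rate_eq_top_of_null (G : SparseGraphSeq.{u})
    {J : BoundedMeasure unitInterval G.D × BoundedMeasure (unitInterval × unitInterval) G.D → ℝ≥0∞}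
    (hJ : SatisfiesLDP (fun n => Measure.pi fun _ : G.V n => (volume : Measure unitInterval))
      (fun n => G.measurePair n) (fun n => (Fintype.card (G.V n) : ℝ)) J)
    {s : BoundedMeasure unitInterval G.D × BoundedMeasure (unitInterval × unitInterval) G.D}
    {T : Set unitInterval} (hT : volume T = 0) {c : ℝ} (hc : 0 < c)
    (h : ∀ W, IsOpen W → T ⊆ W → ∃ U, IsOpen U ∧ s ∈ U ∧ ∀ n (σ : G.V n → unitInterval),
      G.measurePair n σ ∈ U →
        c * Fintype.card (G.V n) < (Finset.univ.filter fun w => σ w ∈ W).card) :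
    J s = ⊤ := by
  by_contra hfin
  obtain ⟨K, hK⟩ : ∃ K : ℝ, (J s : EReal) < K := by
    obtain ⟨K, hK, -⟩ := EReal.lt_iff_exists_real_btwn.1
      (show (J s : EReal) < ⊤ by rw [lt_top_iff_ne_top]; simpa using hfin)
    exact ⟨K, hK⟩
  -- `M` is chosen so that `M * c - log 2` exceeds `K`.
  set M := (|K| + Real.log 2 + 1) / c with hMdef
  have hM : 0 ≤ M := by have := Real.log_nonneg one_le_two; positivity
  have hMc : M * c = |K| + Real.log 2 + 1 := by rw [hMdef]; field_simp
  obtain ⟨W, hTW, hWo, hWv⟩ := Set.exists_isOpen_lt_of_lt T (ENNReal.ofReal (Real.exp (-M)))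
    (by rw [hT]; exact ENNReal.ofReal_pos.2 (Real.exp_pos _))
  obtain ⟨U, hU, hsU, hUW⟩ := h W hWo hTW
  obtain ⟨n, hn⟩ := (hJ.eventually_le hU hsU hK).exists
  have h1 := hn.trans ((measure_mono fun σ hσ => hUW n σ hσ).trans
    (pi_volume_card_lt_le (V := G.V n) (c := c) hM hWv.le))
  rw [ENNReal.ofReal_le_ofReal_iff (Real.exp_pos _).le, Real.exp_le_exp, hMc] at h1
  have := hJ.rate_pos n
  nlinarith [le_abs_self K]

theorem isOpen_lt_fst (D : ℝ≥0) {W : Set unitInterval} (hW : IsOpen W) (c : ℝ) :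
    IsOpen {s : BoundedMeasure unitInterval D × BoundedMeasure (unitInterval × unitInterval) D |
      c < (s.1.1 : Measure unitInterval).real W} :=
  isOpen_iff_mem_nhds.2 fun s hs => eventually_lt_measureReal (μ := s.1.1)
    ((continuous_subtype_val.comp continuous_fst).tendsto s) hW hs

theorem isOpen_lt_snd (D : ℝ≥0) {W : Set (unitInterval × unitInterval)} (hW : IsOpen W) (c : ℝ) :
    IsOpen {s : BoundedMeasure unitInterval D × BoundedMeasure (unitInterval × unitInterval) D |
      c < (s.2.1 : Measure (unitInterval × unitInterval)).real W} :=
  isOpen_iff_mem_nhds.2 fun s hs => eventually_lt_measureReal (μ := s.2.1)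
    ((continuous_subtype_val.comp continuous_snd).tendsto s) hW hs

theorem fst_null_of_rate_ne_top (G : SparseGraphSeq.{u})
    {J : BoundedMeasure unitInterval G.D × BoundedMeasure (unitInterval × unitInterval) G.D → ℝ≥0∞}
    (hJ : SatisfiesLDP (fun n => Measure.pi fun _ : G.V n => (volume : Measure unitInterval))
      (fun n => G.measurePair n) (fun n => (Fintype.card (G.V n) : ℝ)) J)
    {s : BoundedMeasure unitInterval G.D × BoundedMeasure (unitInterval × unitInterval) G.D}
    (hs : J s ≠ ⊤) {T : Set unitInterval} (hT : volume T = 0) :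
    (s.1.1 : Measure unitInterval) T = 0 := by
  by_contra hne
  have hpos : 0 < (s.1.1 : Measure unitInterval).real T :=
    ENNReal.toReal_pos hne (measure_ne_top _ _)
  refine hs (rate_eq_top_of_null G hJ hT (half_pos hpos) fun W hW hTW =>
    ⟨_, isOpen_lt_fst G.D hW _, (half_lt_self hpos).trans_le (measureReal_mono hTW), ?_⟩)
  intro n σ hσ
  have h1 : _ < (rhoMeasure σ : Measure unitInterval).real W := hσ
  rwa [rhoMeasure_real σ hW.measurableSet, lt_div_iff₀ (hJ.rate_pos n)] at h1

open Classical in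
/-- At most `D` oriented edges start in each of the vertices of a given set. -/
theorem card_filter_adj_le {V : Type u} [Fintype V] (G : SimpleGraph V) {D : ℝ≥0}
    (hD : ∀ w, (G.degree w : ℝ≥0) ≤ D) (p : V → Prop) :
    ((Finset.univ.filter fun q : V × V => p q.1 ∧ G.Adj q.1 q.2).card : ℝ) ≤
      D * (Finset.univ.filter p).card := by
  have h : (Finset.univ.filter fun q : V × V => p q.1 ∧ G.Adj q.1 q.2).card =
      ∑ w ∈ Finset.univ.filter p, G.degree w := by
    rw [Finset.card_filter, Fintype.sum_prod_type, Finset.sum_filter]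
    refine Finset.sum_congr rfl fun w _ => ?_
    by_cases hw : p w <;>
      simp [hw, ← SimpleGraph.card_neighborFinset_eq_degree, SimpleGraph.neighborFinset_eq_filter]
  rw [h, mul_comm]
  push_cast
  rw [← nsmul_eq_mul]
  exact Finset.sum_le_card_nsmul _ _ _ fun w _ => by exact_mod_cast hD w

/-- Since every vertex has at most `D` neighbors, the edge measure of a set that confines one of
the two colors to `W` is at most `D` times the vertex measure of `W`. -/
theorem snd_null_of_rate_ne_top (G : SparseGraphSeq.{u})
    {J : BoundedMeasure unitInterval G.D × BoundedMeasure (unitInterval × unitInterval) G.D → ℝ≥0∞}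
    (hJ : SatisfiesLDP (fun n => Measure.pi fun _ : G.V n => (volume : Measure unitInterval))
      (fun n => G.measurePair n) (fun n => (Fintype.card (G.V n) : ℝ)) J)
    {s : BoundedMeasure unitInterval G.D × BoundedMeasure (unitInterval × unitInterval) G.D}
    (hs : J s ≠ ⊤) {T : Set unitInterval} (hT : volume T = 0) :
    (s.2.1 : Measure (unitInterval × unitInterval)) (T ×ˢ Set.univ ∪ Set.univ ×ˢ T) = 0 := by
  classical
  have hD : (0 : ℝ) < G.D := by exact_mod_cast zero_lt_one.trans_le G.one_le_D
  have key : ∀ pr : unitInterval × unitInterval → unitInterval, Continuous pr →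
      (∀ n (σ : G.V n → unitInterval) (W : Set unitInterval),
        ((Finset.univ.filter fun p : G.V n × G.V n =>
          (σ p.1, σ p.2) ∈ pr ⁻¹' W ∧ (G.graph n).Adj p.1 p.2).card : ℝ) ≤
          G.D * (Finset.univ.filter fun w => σ w ∈ W).card) →
      (s.2.1 : Measure (unitInterval × unitInterval)) (pr ⁻¹' T) = 0 := by
    intro pr hpr hcard
    by_contra hne
    have hpos : 0 < (s.2.1 : Measure (unitInterval × unitInterval)).real (pr ⁻¹' T) :=
      ENNReal.toReal_pos hne (measure_ne_top _ _)
    refine hs (rate_eq_top_of_null G hJ hT (div_pos (half_pos hpos) hD) fun W hW hTW =>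
      ⟨_, isOpen_lt_snd G.D (hW.preimage hpr) _,
        (half_lt_self hpos).trans_le (measureReal_mono (Set.preimage_mono hTW)), ?_⟩)
    intro n σ hσ
    have h1 : _ < (muMeasure (G.graph n) σ : Measure (unitInterval × unitInterval)).real
      (pr ⁻¹' W) := hσ
    rw [muMeasure_real _ σ (hW.preimage hpr).measurableSet, lt_div_iff₀ (hJ.rate_pos n)] at h1
    rw [div_mul_eq_mul_div, div_lt_iff₀ hD, mul_comm _ (G.D : ℝ)]
    exact h1.trans_le (hcard n σ W)
  refine measure_union_null ?_ ?_
  · rw [Set.prod_univ]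
    exact key Prod.fst continuous_fst fun n σ W =>
      card_filter_adj_le (G.graph n) (fun w => by convert G.degree_le n w) fun w => σ w ∈ W
  · rw [Set.univ_prod]
    refine key Prod.snd continuous_snd fun n σ W => ?_
    refine le_trans (le_of_eq ?_)
      (card_filter_adj_le (G.graph n) (fun w => by convert G.degree_le n w) fun w => σ w ∈ W)
    refine congrArg Nat.cast (Finset.card_equiv (Equiv.prodComm _ _) fun p => ?_)
    simp [SimpleGraph.adj_comm]

/-! ### Equal subdivision of the unit interval -/

/-- The color class `i` such that `t` lies in `[i / k, (i + 1) / k)`; the point `1` is put into the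
last class. -/
def bucket (k : ℕ) [NeZero k] (t : unitInterval) : Fin k :=
  ⟨min ⌊(k : ℝ) * t⌋₊ (k - 1), by have := NeZero.pos k; omega⟩

theorem measurable_bucket (k : ℕ) [NeZero k] : Measurable (bucket k) := by
  refine measurable_to_countable' fun i => ?_
  have h : Measurable fun t : unitInterval => min ⌊(k : ℝ) * t⌋₊ (k - 1) :=
    (Nat.measurable_floor.comp (measurable_subtype_coe.const_mul _)).min measurable_const
  convert h (measurableSet_singleton (i : ℕ)) using 1
  ext t
  simp [bucket, Fin.ext_iff]

/-- The left end point of a class. -/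
def bucketLeft {k : ℕ} (i : Fin k) : unitInterval :=
  ⟨i / k, by positivity, div_le_one_of_le₀ (by exact_mod_cast i.2.le) (by positivity)⟩

/-- The right end point of a class. -/
def bucketRight {k : ℕ} (i : Fin k) : unitInterval :=
  ⟨(i + 1) / k, by positivity, div_le_one_of_le₀ (by exact_mod_cast i.2) (by positivity)⟩

theorem Ioo_subset_bucket {k : ℕ} [NeZero k] (i : Fin k) :
    Set.Ioo (bucketLeft i) (bucketRight i) ⊆ bucket k ⁻¹' {i} := by
  intro t ht
  have hk : (0 : ℝ) < k := by exact_mod_cast NeZero.pos k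
  have h1 : (i : ℝ) / k < t := ht.1
  have h2 : (t : ℝ) < (i + 1) / k := ht.2
  rw [div_lt_iff₀ hk] at h1
  rw [lt_div_iff₀ hk] at h2
  have h3 : ⌊(k : ℝ) * t⌋₊ = i := by
    rw [Nat.floor_eq_iff (mul_nonneg hk.le t.2.1)]
    constructor <;> linarith
  have := i.2
  simp only [Set.mem_preimage, Set.mem_singleton_iff, bucket, Fin.ext_iff, h3]
  omega

theorem bucket_subset_Icc {k : ℕ} [NeZero k] (i : Fin k) :
    bucket k ⁻¹' {i} ⊆ Set.Icc (bucketLeft i) (bucketRight i) := by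
  intro t ht
  have hk : (0 : ℝ) < k := by exact_mod_cast NeZero.pos k
  have hk' := NeZero.pos k
  simp only [Set.mem_preimage, Set.mem_singleton_iff, bucket, Fin.ext_iff] at ht
  have h0 : 0 ≤ (k : ℝ) * t := mul_nonneg hk.le t.2.1
  have h1 : (i : ℝ) ≤ k * t := (Nat.le_floor_iff h0).1 (by omega)
  have h2 : (k : ℝ) * t ≤ i + 1 := by
    by_cases hf : ⌊(k : ℝ) * t⌋₊ ≤ k - 1
    · rw [min_eq_left hf] at ht
      have := (Nat.lt_floor_add_one ((k : ℝ) * t)).le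
      rwa [ht] at this
    · have h3 : k = (i : ℕ) + 1 := by omega
      have h4 : (k : ℝ) = i + 1 := by exact_mod_cast h3
      rw [← h4]
      exact mul_le_of_le_one_right hk.le t.2.2
  constructor
  · change (i : ℝ) / k ≤ t
    rw [div_le_iff₀ hk]
    linarith
  · change (t : ℝ) ≤ (i + 1) / k
    rw [le_div_iff₀ hk]
    linarith

theorem volume_bucket {k : ℕ} [NeZero k] (i : Fin k) :
    (volume : Measure unitInterval) (bucket k ⁻¹' {i}) = (k : ℝ≥0∞)⁻¹ := by
  have hk : (0 : ℝ) < k := by exact_mod_cast NeZero.pos k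
  have h : ENNReal.ofReal ((bucketRight i : ℝ) - bucketLeft i) = (k : ℝ≥0∞)⁻¹ := by
    have : (bucketRight i : ℝ) - bucketLeft i = (k : ℝ)⁻¹ := by
      simp only [bucketLeft, bucketRight]
      field_simp
      ring
    rw [this, ENNReal.ofReal_inv_of_pos hk, ENNReal.ofReal_natCast]
  refine le_antisymm ?_ ?_
  · exact (measure_mono (bucket_subset_Icc i)).trans (by rw [unitInterval.volume_Icc, h])
  · exact le_trans (by rw [unitInterval.volume_Ioo, h]) (measure_mono (Ioo_subset_bucket i))

theorem volume_frontier_bucket {k : ℕ} [NeZero k] (i : Fin k) :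
    (volume : Measure unitInterval) (frontier (bucket k ⁻¹' {i})) = 0 := by
  have hsub : frontier (bucket k ⁻¹' {i}) ⊆ {bucketLeft i, bucketRight i} := by
    intro t ht
    have h1 := closure_minimal (bucket_subset_Icc i) isClosed_Icc ht.1
    have h2 : t ∉ Set.Ioo (bucketLeft i) (bucketRight i) := fun h =>
      ht.2 (interior_maximal (Ioo_subset_bucket i) isOpen_Ioo h)
    by_contra hne
    simp only [Set.mem_insert_iff, Set.mem_singleton_iff, not_or] at hne
    exact h2 ⟨lt_of_le_of_ne h1.1 (Ne.symm hne.1), lt_of_le_of_ne h1.2 hne.2⟩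
  exact measure_mono_null hsub ((Set.toFinite _).measure_zero _)

/-- Rounding independent uniform colors in `[0, 1]` gives a uniformly random map to `Fin k`. -/
theorem map_bucket_pi_volume (V : Type u) [Fintype V] (k : ℕ) [NeZero k] :
    (Measure.pi fun _ : V => (volume : Measure unitInterval)).map (fun σ w => bucket k (σ w)) =
      ProbabilityTheory.uniformOn (Set.univ : Set (V → Fin k)) := by
  classical
  have hm : Measurable fun (σ : V → unitInterval) w => bucket k (σ w) :=
    measurable_pi_lambda _ fun w => (measurable_bucket k).comp (measurable_pi_apply w)
  refine Measure.ext_of_singleton fun τ => ?_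
  rw [Measure.map_apply hm (measurableSet_singleton τ), ProbabilityTheory.uniformOn_univ,
    Measure.count_singleton]
  have : (fun (σ : V → unitInterval) w => bucket k (σ w)) ⁻¹' {τ} =
      Set.univ.pi fun w => bucket k ⁻¹' {τ w} := by
    ext σ
    simp [funext_iff]
  rw [this, Measure.pi_pi]
  simp [volume_bucket, ENNReal.inv_pow]

/-! ### Quotients as images of the random measures -/

/-- The pair `(ρ(Bᵢ), μ(Bᵢ × Bⱼ))`, where the `Bᵢ` are the `k` classes of `[0, 1]`. -/
def bucketQuotient (k : ℕ) [NeZero k] (D : ℝ≥0)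
    (s : BoundedMeasure unitInterval D × BoundedMeasure (unitInterval × unitInterval) D) :
    QuotientSpace k D :=
  (fun i => ⟨(s.1.1 : Measure unitInterval).real (bucket k ⁻¹' {i}), measureReal_nonneg,
      (measureReal_mono (Set.subset_univ _)).trans (by exact_mod_cast s.1.2)⟩,
   fun i j => ⟨(s.2.1 : Measure (unitInterval × unitInterval)).real
      ((bucket k ⁻¹' {i}) ×ˢ (bucket k ⁻¹' {j})), measureReal_nonneg,
      (measureReal_mono (Set.subset_univ _)).trans (by exact_mod_cast s.2.2)⟩)

theorem bucketQuotient_measurePair (G : SparseGraphSeq.{u}) (k : ℕ) [NeZero k] (n : ℕ)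
    (σ : G.V n → unitInterval) : bucketQuotient k G.D (G.measurePair n σ) =
      G.quotient k n fun w => bucket k (σ w) := by
  classical
  have hm := fun i => measurable_bucket k (measurableSet_singleton i)
  refine Prod.ext (funext fun i => Subtype.ext ?_) (funext fun i => funext fun j => Subtype.ext ?_)
  · refine (rhoMeasure_real σ (hm i)).trans ?_
    simp only [SparseGraphSeq.quotient, quotientNode]
    congr!
  · refine (muMeasure_real (G.graph n) σ ((hm i).prod (hm j))).trans ?_
    simp only [SparseGraphSeq.quotient, quotientEdge]
    congr! 3
    ext p
    simp [and_assoc]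

theorem continuousAt_bucketQuotient (k : ℕ) [NeZero k] {D : ℝ≥0}
    {s : BoundedMeasure unitInterval D × BoundedMeasure (unitInterval × unitInterval) D}
    (h1 : ∀ i : Fin k, (s.1.1 : Measure unitInterval) (frontier (bucket k ⁻¹' {i})) = 0)
    (h2 : ∀ i j : Fin k, (s.2.1 : Measure (unitInterval × unitInterval))
      (frontier ((bucket k ⁻¹' {i}) ×ˢ (bucket k ⁻¹' {j}))) = 0) :
    ContinuousAt (bucketQuotient k D) s := by
  refine ContinuousAt.prodMk (continuousAt_pi.2 fun i => ?_)
    (continuousAt_pi.2 fun i => continuousAt_pi.2 fun j => ?_)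
  · exact tendsto_subtype_rng.2 (tendsto_measureReal_of_null_frontier (μ := s.1.1)
      ((continuous_subtype_val.comp continuous_fst).tendsto s) (h1 i))
  · exact tendsto_subtype_rng.2 (tendsto_measureReal_of_null_frontier (μ := s.2.1)
      ((continuous_subtype_val.comp continuous_snd).tendsto s) (h2 i j))

theorem SparseGraphSeq.LDConvergent.exists_isQuotientRate {G : SparseGraphSeq.{u}}
    (hG : G.LDConvergent) {k : ℕ} (hk : 1 ≤ k) :
    ∃ J : QuotientSpace k G.D → ℝ≥0∞, G.IsQuotientRate k J := by
  have : NeZero k := ⟨by omega⟩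
  obtain ⟨J, hJ⟩ := hG
  refine ⟨_, hJ.contraction (bucketQuotient k G.D) (fun s hs => ?_) (fun n => ?_)
    fun n A => ?_⟩
  · refine continuousAt_bucketQuotient k
      (fun i => fst_null_of_rate_ne_top G hJ hs (volume_frontier_bucket i)) fun i j => ?_
    have hi := measure_mono_null Set.subset_union_left
      (snd_null_of_rate_ne_top G hJ hs (volume_frontier_bucket i))
    have hj := measure_mono_null Set.subset_union_right
      (snd_null_of_rate_ne_top G hJ hs (volume_frontier_bucket j))
    rw [frontier_prod_eq]
    exact measure_union_null (measure_mono_null (Set.prod_mono_left (Set.subset_univ _)) hj)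
      (measure_mono_null (Set.prod_mono_right (Set.subset_univ _)) hi)
  · exact ProbabilityTheory.isProbabilityMeasure_uniformOn Set.finite_univ Set.univ_nonempty
  · have hm : Measurable fun (σ : G.V n → unitInterval) w => bucket k (σ w) :=
      measurable_pi_lambda _ fun w => (measurable_bucket k).comp (measurable_pi_apply w)
    rw [← map_bucket_pi_volume, Measure.map_apply hm (Set.toFinite _).measurableSet]
    congr 1
    ext σ
    simp [bucketQuotient_measurePair]

/-! ### Homomorphism numbers as exponential moments of the energy -/

open Classical in
/-- Every edge carries two oriented edges. -/
theorem sum_adj_eq_two_mul_sum_edgeFinset {V : Type u} [Fintype V] (G : SimpleGraph V)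
    (f : Sym2 V → ℝ) :
    ∑ p : V × V, (if G.Adj p.1 p.2 then f s(p.1, p.2) else 0) = 2 * ∑ e ∈ G.edgeFinset, f e := by
  have h1 : ∑ p : V × V, (if G.Adj p.1 p.2 then f s(p.1, p.2) else 0) =
      ∑ d : G.Dart, f d.edge := by
    rw [← Finset.sum_filter]
    refine (Finset.sum_bij (fun (d : G.Dart) _ => d.toProd) ?_ ?_ ?_ ?_).symm
    · intro d _
      simp
    · intro d _ d' _ h
      exact SimpleGraph.Dart.ext _ _ h
    · intro p hp
      exact ⟨⟨p, by simpa using hp⟩, Finset.mem_univ _, rfl⟩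
    · intro d _
      rfl
  rw [h1, ← Finset.sum_fiberwise_of_maps_to (s := Finset.univ) (t := G.edgeFinset)
    (g := fun d : G.Dart => d.edge) (fun d _ => by simp), Finset.mul_sum]
  refine Finset.sum_congr rfl fun e he => ?_
  rw [Finset.sum_congr rfl (g := fun _ => f e) fun d hd => by rw [(Finset.mem_filter.1 hd).2],
    Finset.sum_const, G.dart_edge_fiber_card e (by simpa using he), nsmul_eq_mul]
  norm_num

open Classical in
theorem sum_card_fiber_mul {ι κ : Type*} [Fintype ι] [Fintype κ] (g : ι → κ) (q : ι → Prop)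
    (c : κ → ℝ) : ∑ i, ((Finset.univ.filter fun a => g a = i ∧ q a).card : ℝ) * c i =
      ∑ a, if q a then c (g a) else 0 := by
  simp only [Finset.card_filter, Nat.cast_sum, Finset.sum_mul]
  rw [Finset.sum_comm]
  refine Finset.sum_congr rfl fun a _ => ?_
  by_cases hq : q a <;> simp [hq]

open Classical in
theorem card_mul_sum_quotientNode_mul {V : Type u} [Fintype V] (hV : 0 < Fintype.card V) {k : ℕ}
    (σ : V → Fin k) (c : Fin k → ℝ) :
    Fintype.card V * ∑ i, quotientNode σ i * c i = ∑ w, c (σ w) := by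
  have hV' : (Fintype.card V : ℝ) ≠ 0 := by exact_mod_cast hV.ne'
  have h := sum_card_fiber_mul σ (fun _ => True) c
  simp only [and_true, if_true] at h
  rw [← h, Finset.mul_sum]
  refine Finset.sum_congr rfl fun i _ => ?_
  rw [quotientNode]
  field_simp

open Classical in
theorem card_mul_sum_quotientEdge_mul {V : Type u} [Fintype V] (hV : 0 < Fintype.card V)
    (G : SimpleGraph V) {k : ℕ} (σ : V → Fin k) (c : Fin k → Fin k → ℝ) :
    Fintype.card V * ∑ i, ∑ j, quotientEdge G σ i j * c i j =
      ∑ p : V × V, if G.Adj p.1 p.2 then c (σ p.1) (σ p.2) else 0 := by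
  have hV' : (Fintype.card V : ℝ) ≠ 0 := by exact_mod_cast hV.ne'
  have h := sum_card_fiber_mul (fun p : V × V => (σ p.1, σ p.2)) (fun p => G.Adj p.1 p.2)
    fun i => c i.1 i.2
  rw [← h, Fintype.sum_prod_type, Finset.mul_sum]
  refine Finset.sum_congr rfl fun i _ => ?_
  rw [Finset.mul_sum]
  refine Finset.sum_congr rfl fun j _ => ?_
  simp only [quotientEdge, Prod.mk.injEq, and_assoc]
  field_simp

open Classical in
theorem weightedHom_eq_sum_exp (G : SparseGraphSeq.{u}) {k : ℕ} (n : ℕ)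
    (hn : 0 < Fintype.card (G.V n)) (H : WeightedGraph k) (hH : H.SoftCore) :
    weightedHom (G.graph n) H =
      ∑ σ : G.V n → Fin k, Real.exp (-(Fintype.card (G.V n) * energy H (G.quotient k n σ))) := by
  unfold weightedHom
  refine Finset.sum_congr rfl fun σ _ => ?_
  set A : Sym2 (G.V n) → ℝ := Sym2.lift ⟨fun a b => H.A (σ a) (σ b), fun a b => H.symm (σ a) (σ b)⟩
    with hA
  have hApos : ∀ e, 0 < A e := fun e => Sym2.ind (fun a b => hH.2 (σ a) (σ b)) e
  have h1 := card_mul_sum_quotientNode_mul hn σ fun i => Real.log (H.α i)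
  have h2 := card_mul_sum_quotientEdge_mul hn (G.graph n) σ fun i j => Real.log (H.A i j)
  have h3 := sum_adj_eq_two_mul_sum_edgeFinset (G.graph n) fun e => Real.log (A e)
  have h4 : -(Fintype.card (G.V n) * energy H (G.quotient k n σ)) =
      ∑ w, Real.log (H.α (σ w)) + ∑ e ∈ (G.graph n).edgeFinset, Real.log (A e) := by
    have h5 := h2.trans h3
    simp only [energy, SparseGraphSeq.quotient]
    linear_combination h1 + h5 / 2
  rw [h4, Real.exp_add, Real.exp_sum, Real.exp_sum]
  congr 1
  · exact Finset.prod_congr rfl fun w _ => (Real.exp_log (hH.1 _)).symm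
  · exact Finset.prod_congr rfl fun e _ => (Real.exp_log (hApos e)).symm

theorem ofReal_weightedHom_eq_lintegral (G : SparseGraphSeq.{u}) {k : ℕ} (hk : 1 ≤ k) (n : ℕ)
    (hn : 0 < Fintype.card (G.V n)) (H : WeightedGraph k) (hH : H.SoftCore) :
    ENNReal.ofReal (weightedHom (G.graph n) H) =
      ∫⁻ σ, ENNReal.ofReal (Real.exp (-(Fintype.card (G.V n) *
        (energy H (G.quotient k n σ) - Real.log k))))
          ∂ProbabilityTheory.uniformOn (Set.univ : Set (G.V n → Fin k)) := by
  classical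
  have hk0 : (0 : ℝ) < k := by exact_mod_cast hk
  rw [weightedHom_eq_sum_exp G n hn H hH, lintegral_fintype,
    ENNReal.ofReal_sum_of_nonneg fun _ _ => (Real.exp_pos _).le]
  refine Finset.sum_congr rfl fun σ _ => ?_
  have h1 : ProbabilityTheory.uniformOn (Set.univ : Set (G.V n → Fin k)) {σ} =
      ENNReal.ofReal (Real.exp (-(Fintype.card (G.V n) * Real.log k))) := by
    rw [ProbabilityTheory.uniformOn_univ, Measure.count_singleton, Real.exp_neg,
      Real.exp_nat_mul, Real.exp_log hk0, ENNReal.ofReal_inv_of_pos (by positivity),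
      ENNReal.ofReal_pow hk0.le, ENNReal.ofReal_natCast]
    simp
  rw [h1, ← ENNReal.ofReal_mul (Real.exp_pos _).le, ← Real.exp_add]
  congr 2
  ring

theorem continuous_energy {k : ℕ} {D : ℝ≥0} (H : WeightedGraph k) :
    Continuous (energy H : QuotientSpace k D → ℝ) := by
  unfold energy
  fun_prop

theorem coe_energy_sub_entropy {k : ℕ} {D : ℝ≥0} (H : WeightedGraph k)
    (J : QuotientSpace k D → ℝ≥0∞) (p : QuotientSpace k D) :
    (energy H p : EReal) - entropy J p =
      ((energy H p - Real.log k : ℝ) : EReal) + (J p : EReal) := by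
  rw [entropy, sub_eq_add_neg, EReal.neg_sub (by simp) (by simp), EReal.coe_sub, sub_eq_add_neg,
    add_assoc]

theorem SparseGraphSeq.IsQuotientRate.exists_tendsto {G : SparseGraphSeq.{u}} {k : ℕ} (hk : 1 ≤ k)
    {J : QuotientSpace k G.D → ℝ≥0∞} (hJ : G.IsQuotientRate k J) (H : WeightedGraph k)
    (hH : H.SoftCore) : ∃ F : ℝ,
      Tendsto (fun n => -((1 / (Fintype.card (G.V n) : ℝ)) *
        Real.log (weightedHom (G.graph n) H))) atTop (𝓝 F) ∧
      (F : EReal) = ⨅ p : QuotientSpace k G.D, ((energy H p : EReal) - entropy J p) := by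
  classical
  have : Nonempty (Fin k) := ⟨⟨0, hk⟩⟩
  have hn : ∀ n, 0 < Fintype.card (G.V n) := fun n => by exact_mod_cast hJ.rate_pos n
  have hf : Continuous fun p : QuotientSpace k G.D => energy H p - Real.log k :=
    (continuous_energy H).sub continuous_const
  obtain ⟨B, hB⟩ := isCompact_univ.exists_bound_of_continuousOn hf.continuousOn
  have hpos : ∀ n, 0 < weightedHom (G.graph n) H := fun n => by
    rw [weightedHom_eq_sum_exp G n (hn n) H hH]
    exact Finset.sum_pos (fun _ _ => Real.exp_pos _) Finset.univ_nonempty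
  simp only [coe_energy_sub_entropy]
  exact hJ.varadhan hf (fun p => hB p (Set.mem_univ p)) (fun n => measurable_of_finite _) hpos
    fun n => ofReal_weightedHom_eq_lintegral G hk n (hn n) H hH

end SparseGraph
end

theorem mainTheorem2 (G : SparseGraph.SparseGraphSeq.{u}) (hG : G.LDConvergent) :
    G.RightConvergent ∧
    ∀ k : ℕ, 1 ≤ k →
      (∃! J : SparseGraph.QuotientSpace k G.D → ℝ≥0∞, G.IsQuotientRate k J) ∧
      ∀ J : SparseGraph.QuotientSpace k G.D → ℝ≥0∞, G.IsQuotientRate k J →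
        ∀ H : SparseGraph.WeightedGraph k, H.SoftCore →
          ∃ F : ℝ,
            Tendsto (fun n => -((1 / (Fintype.card (G.V n) : ℝ)) *
              Real.log (SparseGraph.weightedHom (G.graph n) H))) atTop (𝓝 F) ∧
            (F : EReal) = ⨅ p : SparseGraph.QuotientSpace k G.D,
              ((SparseGraph.energy H p : EReal) - SparseGraph.entropy J p) := by
  refine ⟨fun k hk H hH => ?_, fun k hk => ⟨?_, fun J hJ H hH => hJ.exists_tendsto hk H hH⟩⟩
  · obtain ⟨J, hJ⟩ := hG.exists_isQuotientRate hk
    obtain ⟨F, hF, -⟩ := hJ.exists_tendsto hk H hH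
    refine ⟨-F, hF.neg.congr fun n => ?_⟩
    rw [neg_neg, one_div, ← div_eq_inv_mul]
  · obtain ⟨J, hJ⟩ := hG.exists_isQuotientRate hk
    exact ⟨J, hJ, fun J' hJ' => hJ'.rate_unique hJ⟩
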